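/- A weighted graph $(V,b,m)$ consists of a countably infinite set $V$, a function $m:V\to(0,\infty)$ and a symmetric function $b:V\times V\to[0,\infty)$ vanishing on the diagonal; $x\sim y$ means $b(x,y)>0$, and all graphs are assumed to be connected and locally finite. Let $d$ be the combinatorial graph distance, $S_r(x_0)=\{x: d(x,x_0)=r\}$, and, for a fixed vertex $x_0$ and $x\in S_r(x_0)$, let $$\kappa_\pm(x)=\frac1{m(x)}\sum_{y\in S_{r\pm1}(x_0)}b(x,y)$$ be the outer and inner curvatures (with $S_{-1}(x_0)=\emptyset$). Let $L$ be the positive self-adjoint operator on $\ell^2(V,m)$ associated with the closure of the form $Q(f,g)=\frac12\sum_{x,y}b(x,y)(f(x)-f(y))(g(x)-g(y))$ on finitely supported functions, and let $p_t(x,y)=(e^{-tL}\delta_y)(x)$, $t\ge0$, be its heat kernel, where $\delta_y=\frac1{m(y)}1_{\{y\}}$. A weighted graph $(V^{\mathrm{sym}},b^{\mathrm{sym}},m^{\mathrm{sym}})$ is weakly spherically symmetric with root $o$ if its curvatures $\kappa^{\mathrm{sym}}_\pm$ with respect to $o$ depend only on the distance to $o$; in that case $p^{\mathrm{sym}}_t(o,\cdot)$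 also depends only on the distance to $o$, and one writes $\kappa^{\mathrm{sym}}_\pm(r)$ and $p^{\mathrm{sym}}_t(r)$ for the values on the sphere of radius $r$ around $o$. Theorem (Heat kernel comparison with weakly spherically symmetric graphs). Let $(V,b,m)$ be a weighted graph with heat kernel $p$, let $x_0\in V$, and let $(V^{\mathrm{sym}},b^{\mathrm{sym}},m^{\mathrm{sym}})$ be a weakly spherically symmetric graph with root $o$ and heat kernel $p^{\mathrm{sym}}$. If $(V,b,m)$ has stronger curvature growth, i.e. $m(x_0)=m^{\mathrm{sym}}(o)$ and $\kappa_+(x)\ge\kappa_+^{\mathrm{sym}}(r)$, $\kappa_-(x)\le\kappa_-^{\mathrm{sym}}(r)$ for all $r\in\{0,1,2,\dots\}$ and $x\in S_r(x_0)$, then $$p^{\mathrm{sym}}_t(r)\ \ge\ p_t(x_0,x)\qquad\text{for all } r\in\{0,1,2,\dots\},\ x\in S_r(x_0),\ t\ge0 .$$ If $(V,b,m)$ has weaker curvature growth, i.e. $m(x_0)=m^{\mathrm{sym}}(o)$ and $\kappa_+(x)\le\kappa_+^{\mathrm{sym}}(r)$, $\kappa_-(x)\ge\kappa_-^{\mathrm{sym}}(r)$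 for all $r$ and $x\in S_r(x_0)$, then $p^{\mathrm{sym}}_t(r)\le p_t(x_0,x)$ for all $r\in\{0,1,2,\dots\}$, $x\in S_r(x_0)$, $t\ge0$. -/

import Mathlib

open MeasureTheory
open scoped ENNReal ComplexConjugate

/-- The function with `heatSymbol t (1 / (λ + 1)) = e^{-tλ}` for `λ ≥ 0`, extended continuously to
`[0, 1]` for `t > 0` (and to be constantly `1` on `[0, 1]` for `t = 0`). -/
noncomputable def heatSymbol (t s : ℝ) : ℝ :=
  if s = 0 then (if t = 0 then 1 else 0) else Real.exp (-(t * (1 / s - 1)))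

theorem continuousOn_heatSymbol {t : ℝ} (ht : 0 ≤ t) :
    ContinuousOn (heatSymbol t) (Set.Icc 0 1) := by
  rcases ht.eq_or_lt with rfl | ht
  · have h : heatSymbol 0 = fun _ => 1 := by
      funext s
      simp [heatSymbol]
    rw [h]
    exact continuousOn_const
  intro s hs
  rcases hs.1.eq_or_lt with rfl | h0
  · have h1 : Filter.Tendsto (fun s : ℝ => Real.exp (-(t * (1 / s - 1)))) (nhdsWithin 0 (Set.Ioi 0))
        (nhds 0) := by
      refine Real.tendsto_exp_atBot.comp (Filter.tendsto_neg_atTop_atBot.comp ?_)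
      refine Filter.Tendsto.const_mul_atTop ht ?_
      simp only [one_div, sub_eq_add_neg]
      exact Filter.tendsto_atTop_add_const_right _ _ tendsto_inv_nhdsGT_zero
    have h2 : ContinuousWithinAt (heatSymbol t) (Set.Ioi 0) 0 := by
      have h3 : heatSymbol t 0 = 0 := by simp [heatSymbol, ht.ne']
      rw [ContinuousWithinAt, h3]
      refine h1.congr' ?_
      filter_upwards [self_mem_nhdsWithin] with s hs
      have hs' : s ≠ 0 := (Set.mem_Ioi.1 hs).ne'
      simp [heatSymbol, hs']
    refine (continuousWithinAt_insert_self.2 h2).mono fun s hs => ?_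
    rcases hs.1.eq_or_lt with rfl | h
    · exact Set.mem_insert _ _
    · exact Set.mem_insert_of_mem _ h
  · refine ContinuousAt.continuousWithinAt ?_
    have h3 : ContinuousAt (fun s : ℝ => Real.exp (-(t * (1 / s - 1)))) s := by
      have := h0.ne'
      fun_prop (disch := assumption)
    refine h3.congr ?_
    filter_upwards [lt_mem_nhds h0] with s hs
    simp [heatSymbol, hs.ne']

theorem spectrum_subset_Icc {H : Type*} [NormedAddCommGroup H] [InnerProductSpace ℂ H]
    [CompleteSpace H] {R : H →L[ℂ] H} (hR : R.IsPositive) (hn : ‖R‖ ≤ 1) :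
    spectrum ℝ R ⊆ Set.Icc 0 1 := by
  intro s hs
  refine ⟨?_, ?_⟩
  · exact spectrum_nonneg_of_nonneg ((ContinuousLinearMap.nonneg_iff_isPositive R).2 hR) hs
  · rcases subsingleton_or_nontrivial H with h | h
    · have : IsEmpty (spectrum ℝ R) := by
        rw [spectrum.of_subsingleton]; infer_instance
      exact (this.false ⟨s, hs⟩).elim
    · have := spectrum.norm_le_norm_of_mem hs
      exact (le_abs_self s).trans (this.trans hn)

/-- Let `L ≥ 0` be a self-adjoint operator in `H` and `R = (L + 1)⁻¹`. This is the operator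
`e^{-tL}`, `t ≥ 0`, in the sense of the spectral theorem: the function `λ ↦ e^{-tλ}` of `L` is
written as a continuous function of the bounded self-adjoint operator `R`, to which the continuous
functional calculus is applied. (`R` is self-adjoint with spectrum in `[0, 1]`, where
`heatSymbol t` is continuous.) -/
noncomputable def expNegOfResolvent {H : Type*} [NormedAddCommGroup H] [InnerProductSpace ℂ H]
    [CompleteSpace H] (t : ℝ) (R : H →L[ℂ] H) : H →L[ℂ] H :=
  cfc (heatSymbol t) R

/-- A connected, locally finite weighted graph `(V, b, m)` (without killing term). -/
structure WeightedGraph (V : Type*) where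
  /-- the edge weights -/
  b : V → V → ℝ
  /-- the measure of the vertices -/
  m : V → ℝ
  b_nonneg : ∀ x y, 0 ≤ b x y
  b_symm : ∀ x y, b x y = b y x
  b_self : ∀ x, b x x = 0
  m_pos : ∀ x, 0 < m x
  connected : ∀ x y, Relation.ReflTransGen (fun u v => 0 < b u v) x y
  locallyFinite : ∀ x, {y | b x y ≠ 0}.Finite

namespace WeightedGraph

/-! ### Combinatorial distance, spheres, curvatures -/

section Combinatorics

variable {V : Type*} (G : WeightedGraph V)

/-- The combinatorial graph: `x ∼ y` iff `b x y > 0`. -/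
def graph : SimpleGraph V where
  Adj x y := 0 < G.b x y
  symm := ⟨fun x y h => by rwa [G.b_symm y x]⟩
  loopless := ⟨fun x h => by simp [G.b_self] at h⟩

/-- The combinatorial distance `d(x, y)`. -/
noncomputable def dist (x y : V) : ℕ := G.graph.dist x y

/-- The sphere `S_r(x₀)`. -/
def sphere (x₀ : V) (r : ℕ) : Set V := {x | G.dist x x₀ = r}

/-- The outer curvature `κ₊(x) = (1 / m(x)) ∑_{y ∈ S_{r+1}} b(x, y)`, for `x ∈ S_r`. -/
noncomputable def outerCurvature (x₀ x : V) : ℝ :=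
  1 / G.m x * ∑ᶠ y ∈ {y | G.dist y x₀ = G.dist x x₀ + 1}, G.b x y

/-- The inner curvature `κ₋(x) = (1 / m(x)) ∑_{y ∈ S_{r-1}} b(x, y)`, for `x ∈ S_r`
(where `S_{-1} = ∅`). -/
noncomputable def innerCurvature (x₀ x : V) : ℝ :=
  1 / G.m x * ∑ᶠ y ∈ {y | G.dist y x₀ + 1 = G.dist x x₀}, G.b x y

/-- A function whose values depend only on the distance to `x₀`. -/
def IsSphericallySymmetric (x₀ : V) (f : V → ℝ) : Prop :=
  ∃ g : ℕ → ℝ, ∀ r, ∀ x ∈ G.sphere x₀ r, f x = g r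

/-- `G` is weakly spherically symmetric with root `o`. (There is no potential, hence the
normalized potential vanishes.) -/
def IsWeaklySphericallySymmetric (o : V) : Prop :=
  G.IsSphericallySymmetric o (G.outerCurvature o) ∧
    G.IsSphericallySymmetric o (G.innerCurvature o)

/-- `G` has stronger curvature growth with respect to `x₀` than the (weakly spherically
symmetric) graph `G'` with root `o`. -/
def HasStrongerCurvatureGrowth (x₀ : V) {W : Type*} (G' : WeightedGraph W) (o : W) : Prop :=
  G.m x₀ = G'.m o ∧ ∀ r : ℕ, ∀ x ∈ G.sphere x₀ r, ∀ y ∈ G'.sphere o r,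
    G'.outerCurvature o y ≤ G.outerCurvature x₀ x ∧
      G.innerCurvature x₀ x ≤ G'.innerCurvature o y

/-- `G` has weaker curvature growth with respect to `x₀` than the (weakly spherically
symmetric) graph `G'` with root `o`. -/
def HasWeakerCurvatureGrowth (x₀ : V) {W : Type*} (G' : WeightedGraph W) (o : W) : Prop :=
  G.m x₀ = G'.m o ∧ ∀ r : ℕ, ∀ x ∈ G.sphere x₀ r, ∀ y ∈ G'.sphere o r,
    G.outerCurvature x₀ x ≤ G'.outerCurvature o y ∧
      G'.innerCurvature o y ≤ G.innerCurvature x₀ x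

end Combinatorics

/-! ### The form `Q` on functions -/

section Form

variable {V : Type*} (G : WeightedGraph V)

/-- The form `Q(f, g) = (1 / 2) ∑_{x, y} b(x, y) (f(x) - f(y)) (g(x) - g(y))`, extended
sesquilinearly to complex valued functions. -/
noncomputable def form (f g : V → ℂ) : ℂ :=
  1 / 2 * ∑' p : V × V, (G.b p.1 p.2 : ℂ) * (conj (f p.1 - f p.2) * (g p.1 - g p.2))

/-- The square of the form norm, `‖f‖² + Q(f, f) ∈ [0, ∞]`. -/
noncomputable def formNormSq (f : V → ℂ) : ℝ≥0∞ :=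
  ∑' x, ENNReal.ofReal (G.m x) * ‖f x‖ₑ ^ 2 +
    2⁻¹ * ∑' p : V × V, ENNReal.ofReal (G.b p.1 p.2) * ‖f p.1 - f p.2‖ₑ ^ 2

/-- The weighted discrete gradient, normalized so that `Q(f, g) = ⟨grad f, grad g⟩`. -/
noncomputable def grad (f : V → ℂ) (p : V × V) : ℂ :=
  (Real.sqrt (G.b p.1 p.2 / 2) : ℂ) * (f p.1 - f p.2)

theorem formNormSq_eq (f : V → ℂ) : G.formNormSq f =
    ∑' x, ENNReal.ofReal (G.m x) * ‖f x‖ₑ ^ 2 + ∑' p, ‖G.grad f p‖ₑ ^ 2 := by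
  rw [formNormSq, ← ENNReal.tsum_mul_left]
  congr 2
  funext p
  rw [grad, enorm_mul, mul_pow, ← mul_assoc]
  congr 1
  have hb := G.b_nonneg p.1 p.2
  rw [← enorm_pow, ← Complex.ofReal_pow, Real.sq_sqrt (by positivity), ← ofReal_norm,
    Complex.norm_real, Real.norm_of_nonneg (by positivity), ENNReal.ofReal_div_of_pos (by norm_num),
    div_eq_mul_inv, mul_comm]
  simp

theorem form_eq (f g : V → ℂ) :
    G.form f g = ∑' p, inner ℂ (G.grad f p) (G.grad g p) := by
  rw [form, ← tsum_mul_left]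
  congr 1
  funext p
  have hb := G.b_nonneg p.1 p.2
  have h : ((Real.sqrt (G.b p.1 p.2 / 2) : ℂ)) * (Real.sqrt (G.b p.1 p.2 / 2) : ℂ) =
      (G.b p.1 p.2 : ℂ) / 2 := by
    rw [← Complex.ofReal_mul, Real.mul_self_sqrt (by positivity)]
    push_cast
    ring
  simp only [grad, RCLike.inner_apply, map_mul, Complex.conj_ofReal]
  linear_combination (-(conj (f p.1 - f p.2) * (g p.1 - g p.2))) * h

theorem memlp_of_tsum {u : V × V → ℂ} (h : ∑' p, ‖u p‖ₑ ^ 2 ≠ ∞) : Memℓp u 2 := by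
  rw [memℓp_gen_iff (by simp)]
  have h2 := ENNReal.summable_toReal h
  refine h2.congr fun p => ?_
  simp

theorem tsum_of_memlp (u : lp (fun _ : V × V => ℂ) 2) : ‖u‖ₑ ^ 2 = ∑' p, ‖u p‖ₑ ^ 2 := by
  have hs : Summable fun p => ‖u p‖ ^ 2 := by
    simpa using (memℓp_gen_iff (by simp)).1 (lp.memℓp u)
  have h := lp.norm_rpow_eq_tsum (p := 2) (by simp) u
  simp only [ENNReal.toReal_ofNat, Real.rpow_ofNat] at h
  rw [← ofReal_norm, ← ENNReal.ofReal_pow (norm_nonneg _), h,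
    ENNReal.ofReal_tsum_of_nonneg (fun _ => by positivity) hs]
  simp [ENNReal.ofReal_pow]

theorem grad_support_finite {φ : V → ℂ} (hφ : φ.support.Finite) :
    (G.grad φ).support.Finite := by
  refine Set.Finite.subset (((hφ.biUnion fun x _ => (Set.finite_singleton x).prod
    (G.locallyFinite x))).union ((hφ.biUnion fun x _ => (G.locallyFinite x).prod
    (Set.finite_singleton x)))) ?_
  rintro ⟨x, y⟩ hp
  have hb : G.b x y ≠ 0 := by
    intro h
    simp [grad, h] at hp
  by_cases hx : φ x = 0
  · right
    have hy : φ y ≠ 0 := by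
      intro hy
      simp [grad, hx, hy] at hp
    simp only [Set.mem_iUnion]
    exact ⟨y, hy, by simpa [G.b_symm y x] using hb⟩
  · left
    simp only [Set.mem_iUnion]
    exact ⟨x, hx, by simpa using hb⟩

theorem formNormSq_ne_top {φ : V → ℂ} (hφ : φ.support.Finite) : G.formNormSq φ ≠ ∞ := by
  rw [formNormSq_eq]
  refine ENNReal.add_ne_top.2 ⟨?_, ?_⟩
  · rw [tsum_eq_sum (s := hφ.toFinset) (fun x hx => by simpa using Or.inr hx)]
    exact ENNReal.sum_ne_top.2 fun x _ =>
      ENNReal.mul_ne_top ENNReal.ofReal_ne_top (by simp)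
  · rw [tsum_eq_sum (s := (G.grad_support_finite hφ).toFinset) (fun x hx => by simpa using hx)]
    exact ENNReal.sum_ne_top.2 fun x _ => by simp

theorem grad_sub (f g : V → ℂ) (p : V × V) :
    G.grad (fun x => f x - g x) p = G.grad f p - G.grad g p := by
  simp only [grad]
  ring

end Form

/-! ### The Hilbert space `ℓ²(V, m)`, the form domain and the Laplacian `L` -/

section Analysis

variable {V : Type*} [MeasurableSpace V] (G : WeightedGraph V)

/-- The measure `m` on subsets of `V`: `m(A) = ∑_{x ∈ A} m(x)`. -/
noncomputable def measure : Measure V :=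
  Measure.sum fun x => ENNReal.ofReal (G.m x) • Measure.dirac x

/-- The (complexified) Hilbert space `ℓ²(V, m)`. As `m` has full support, its elements are
functions on `V`. -/
noncomputable abbrev l2 : Type _ := Lp ℂ 2 G.measure

/-- The form domain `D(Q)`: the closure of the finitely supported functions in `ℓ²(V, m)` with
respect to the form norm. -/
def formDomain : Set G.l2 :=
  {f | ∀ ε : ℝ≥0∞, 0 < ε → ∃ φ : V → ℂ, φ.support.Finite ∧
    G.formNormSq (fun x => f x - φ x) < ε}

/-- The self-adjoint operator `L` associated with `Q`, as a graph:
`G.IsLaplacian f u` says that `f ∈ D(L)` and `L f = u`. -/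
def IsLaplacian (f u : G.l2) : Prop :=
  f ∈ G.formDomain ∧ ∀ g ∈ G.formDomain, G.form f g = inner ℂ u g

theorem memlp_grad {f : G.l2} (hf : f ∈ G.formDomain) : Memℓp (G.grad f) 2 := by
  obtain ⟨φ, hφ, h⟩ := hf 1 one_pos
  have h1 : G.formNormSq (fun x => f x - φ x) ≠ ∞ := (h.trans ENNReal.one_lt_top).ne
  have h2 := G.formNormSq_ne_top hφ
  rw [formNormSq_eq] at h1 h2
  have h3 := (memlp_of_tsum (ENNReal.add_ne_top.1 h1).2).add
    (memlp_of_tsum (ENNReal.add_ne_top.1 h2).2)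
  convert h3 using 1
  funext p
  simp [grad_sub]

/-! ### Existence of the resolvent `(L + 1)⁻¹` -/

section Discrete

variable [Countable V] [DiscreteMeasurableSpace V]

theorem measure_singleton (x : V) : G.measure {x} = ENNReal.ofReal (G.m x) := by
  rw [measure, Measure.sum_apply _ (MeasurableSet.singleton x)]
  rw [tsum_eq_single x]
  · simp
  · intro y hy
    simp [hy]

theorem ae_measure_iff {P : V → Prop} : (∀ᵐ x ∂G.measure, P x) ↔ ∀ x, P x := by
  refine ⟨fun h x => ?_, fun h => Filter.Eventually.of_forall h⟩
  by_contra hx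
  have h0 : G.measure {x} = 0 := measure_mono_null (by simpa using hx) (ae_iff.1 h)
  rw [measure_singleton, ENNReal.ofReal_eq_zero] at h0
  exact absurd (G.m_pos x) (not_lt.2 h0)

theorem lintegral_measure (F : V → ℝ≥0∞) :
    ∫⁻ x, F x ∂G.measure = ∑' x, ENNReal.ofReal (G.m x) * F x := by
  simp [measure, lintegral_sum_measure, lintegral_smul_measure]

theorem coe_add_apply (f g : G.l2) (x : V) : (f + g : G.l2) x = f x + g x :=
  G.ae_measure_iff.1 (Lp.coeFn_add f g) x

theorem coe_sub_apply (f g : G.l2) (x : V) : (f - g : G.l2) x = f x - g x :=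
  G.ae_measure_iff.1 (Lp.coeFn_sub f g) x

theorem coe_smul_apply (c : ℂ) (f : G.l2) (x : V) : (c • f : G.l2) x = c * f x :=
  G.ae_measure_iff.1 (Lp.coeFn_smul c f) x

theorem coe_zero_apply (x : V) : (0 : G.l2) x = 0 :=
  G.ae_measure_iff.1 (Lp.coeFn_zero ℂ 2 G.measure) x

theorem eLpNorm_sq (f : V → ℂ) :
    eLpNorm f 2 G.measure ^ 2 = ∑' x, ENNReal.ofReal (G.m x) * ‖f x‖ₑ ^ 2 := by
  rw [← lintegral_measure, eLpNorm_eq_lintegral_rpow_enorm_toReal (by simp) (by simp),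
    ← ENNReal.rpow_natCast, ← ENNReal.rpow_mul]
  simp

theorem enorm_sq (f : G.l2) :
    ‖f‖ₑ ^ 2 = ∑' x, ENNReal.ofReal (G.m x) * ‖f x‖ₑ ^ 2 := by
  rw [← eLpNorm_sq, Lp.enorm_def]


theorem continuous_coe_apply (x : V) : Continuous fun f : G.l2 => f x := by
  have hm : G.measure {x} ≠ ∞ := by rw [measure_singleton]; exact ENNReal.ofReal_ne_top
  have hpos : G.measure.real {x} ≠ 0 := by
    rw [Measure.real, measure_singleton, ENNReal.toReal_ofReal (G.m_pos x).le]
    exact (G.m_pos x).ne'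
  have h : (fun f : G.l2 => f x) = fun f : G.l2 => (G.measure.real {x})⁻¹ •
      inner ℂ (indicatorConstLp 2 (MeasurableSet.singleton x) hm (1 : ℂ)) f := by
    funext f
    rw [L2.inner_indicatorConstLp_one, integral_singleton, smul_smul, inv_mul_cancel₀ hpos,
      one_smul]
  rw [h]
  fun_prop

theorem memLp_of_finite {φ : V → ℂ} (hφ : φ.support.Finite) : MemLp φ 2 G.measure := by
  refine ⟨(measurable_of_countable φ).aestronglyMeasurable, ?_⟩
  have h := G.formNormSq_ne_top hφ
  rw [formNormSq_eq, ← eLpNorm_sq] at h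
  have h1 := (ENNReal.add_ne_top.1 h).1
  rw [lt_top_iff_ne_top]
  intro h2
  simp [h2] at h1

/-- The Hilbert space containing all pairs `(f, grad f)`. -/
noncomputable abbrev pairSpace : Type _ := WithLp 2 (G.l2 × lp (fun _ : V × V => ℂ) 2)

theorem enorm_sq_pair (z : G.pairSpace) :
    ‖z‖ₑ ^ 2 = ∑' x, ENNReal.ofReal (G.m x) * ‖z.fst x‖ₑ ^ 2 + ∑' p, ‖z.snd p‖ₑ ^ 2 := by
  rw [← tsum_of_memlp, ← enorm_sq, ← ofReal_norm, ← ENNReal.ofReal_pow (norm_nonneg _),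
    WithLp.prod_norm_sq_eq_of_L2, ENNReal.ofReal_add (by positivity) (by positivity),
    ENNReal.ofReal_pow (norm_nonneg _), ENNReal.ofReal_pow (norm_nonneg _), ofReal_norm, ofReal_norm]

/-- All pairs `(φ, grad φ)` with `φ` finitely supported. -/
noncomputable def finitePairs : Submodule ℂ G.pairSpace where
  carrier := {z | (Function.support (z.fst : V → ℂ)).Finite ∧ ∀ p, z.snd p = G.grad z.fst p}
  add_mem' := by
    rintro a b ⟨ha, ha'⟩ ⟨hb, hb'⟩
    refine ⟨(ha.union hb).subset fun x hx => ?_, fun p => ?_⟩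
    · by_contra h
      simp only [Set.mem_union, Function.mem_support, not_or, not_not] at h
      exact hx (by rw [WithLp.add_fst, coe_add_apply, h.1, h.2, add_zero])
    · simp only [WithLp.add_fst, WithLp.add_snd, lp.coeFn_add, Pi.add_apply, ha', hb', grad,
        coe_add_apply]
      ring
  zero_mem' := by
    refine ⟨?_, fun p => ?_⟩
    · convert Set.finite_empty (α := V)
      ext x
      simp only [WithLp.zero_fst, Function.mem_support, ne_eq, Set.mem_empty_iff_false, iff_false,
        not_not]
      exact G.coe_zero_apply x
    · simp only [WithLp.zero_fst, WithLp.zero_snd, grad]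
      rw [G.coe_zero_apply, G.coe_zero_apply]
      simp
  smul_mem' := by
    rintro c a ⟨ha, ha'⟩
    refine ⟨ha.subset fun x hx => ?_, fun p => ?_⟩
    · intro h
      simp [coe_smul_apply, h] at hx
    · simp only [WithLp.smul_fst, WithLp.smul_snd, lp.coeFn_smul, Pi.smul_apply, ha', grad,
        coe_smul_apply, smul_eq_mul]
      ring

/-- The form domain with the form inner product, realized as a space of pairs `(f, grad f)`. -/
noncomputable def formSpace : Submodule ℂ G.pairSpace := G.finitePairs.topologicalClosure

theorem mem_formSpace_iff (z : G.pairSpace) :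
    z ∈ G.formSpace ↔ z.fst ∈ G.formDomain ∧ ∀ p, z.snd p = G.grad z.fst p := by
  have key : ∀ w : G.pairSpace, (∀ p, z.snd p = G.grad z.fst p) →
      (∀ p, w.snd p = G.grad w.fst p) →
      edist z w ^ 2 = G.formNormSq (fun x => z.fst x - w.fst x) := by
    intro w hz hw
    rw [edist_eq_enorm_sub, enorm_sq_pair, formNormSq_eq]
    simp only [WithLp.sub_fst, WithLp.sub_snd, coe_sub_apply, grad_sub, lp.coeFn_sub,
      Pi.sub_apply, hz, hw]
  rw [formSpace, ← SetLike.mem_coe, Submodule.topologicalClosure_coe]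
  constructor
  · intro h
    have hcl : IsClosed {z : G.pairSpace | ∀ p, z.snd p = G.grad z.fst p} := by
      simp only [Set.ofPred_forall]
      refine isClosed_iInter fun p => isClosed_eq ?_ ?_
      · exact ((lp.evalCLM ℂ (fun _ : V × V => ℂ) 2 p).continuous).comp
          (WithLp.continuous_snd 2 _ _)
      · unfold grad
        have h1 := (G.continuous_coe_apply p.1).comp
          (WithLp.continuous_fst 2 G.l2 (lp (fun _ : V × V => ℂ) 2))
        have h2 := (G.continuous_coe_apply p.2).comp
          (WithLp.continuous_fst 2 G.l2 (lp (fun _ : V × V => ℂ) 2))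
        exact continuous_const.mul (h1.sub h2)
    have hz : ∀ p, z.snd p = G.grad z.fst p :=
      closure_minimal (fun w hw => hw.2) hcl h
    refine ⟨fun ε hε => ?_, hz⟩
    obtain ⟨δ, hδ, hδε⟩ : ∃ δ : ℝ≥0∞, 0 < δ ∧ δ ^ 2 ≤ ε := by
      refine ⟨min ε 1, lt_min hε one_pos, ?_⟩
      calc (min ε 1) ^ 2 = min ε 1 * min ε 1 := sq _
        _ ≤ ε * 1 := mul_le_mul' (min_le_left _ _) (min_le_right _ _)
        _ = ε := mul_one _
    obtain ⟨w, hw, hd⟩ := EMetric.mem_closure_iff.1 h δ hδ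
    refine ⟨w.fst, hw.1, ?_⟩
    rw [← key w hz hw.2]
    exact (ENNReal.pow_lt_pow_left two_ne_zero hd).trans_le hδε
  · rintro ⟨h, hz⟩
    rw [EMetric.mem_closure_iff]
    intro ε hε
    obtain ⟨φ, hφ, hlt⟩ := h (ε ^ 2) (by positivity)
    have hL := G.memLp_of_finite hφ
    have hc : ∀ x, (hL.toLp φ : V → ℂ) x = φ x := G.ae_measure_iff.1 hL.coeFn_toLp
    have hc' : ((hL.toLp φ : G.l2) : V → ℂ) = φ := funext hc
    have hg : Memℓp (G.grad φ) 2 := by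
      have h2 := G.formNormSq_ne_top hφ
      rw [formNormSq_eq] at h2
      exact memlp_of_tsum (ENNReal.add_ne_top.1 h2).2
    let w : G.pairSpace := WithLp.toLp 2 (hL.toLp φ, ⟨G.grad φ, hg⟩)
    have hw1 : (w.fst : V → ℂ) = φ := hc'
    have hw : ∀ p, w.snd p = G.grad w.fst p := by
      intro p
      rw [hw1]
      rfl
    refine ⟨w, ⟨by rw [hw1]; exact hφ, hw⟩, ?_⟩
    rw [← hw1, ← key w hz hw] at hlt
    exact lt_of_pow_lt_pow_left' 2 hlt

/-- The resolvent `(L + 1)⁻¹` exists as a bounded operator on `ℓ²(V, m)`, and is a positive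
self-adjoint contraction. -/
theorem exists_resolvent : ∃ R : G.l2 →L[ℂ] G.l2,
    (∀ f u : G.l2, R (u + f) = f ↔ G.IsLaplacian f u) ∧ R.IsPositive ∧ ‖R‖ ≤ 1 := by
  have : CompleteSpace G.formSpace :=
    (Submodule.isClosed_topologicalClosure _).completeSpace_coe
  let ι : G.formSpace →L[ℂ] G.l2 :=
    (WithLp.fstL 2 ℂ G.l2 (lp (fun _ : V × V => ℂ) 2)).comp G.formSpace.subtypeL
  have hι : ∀ k : G.formSpace, ι k = (k : G.pairSpace).fst := fun _ => rfl
  have hιn : ‖ι‖ ≤ 1 := by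
    refine ContinuousLinearMap.opNorm_le_bound _ zero_le_one fun k => ?_
    rw [one_mul, hι]
    refine le_of_sq_le_sq ?_ (norm_nonneg _)
    rw [Submodule.coe_norm, WithLp.prod_norm_sq_eq_of_L2]
    nlinarith [sq_nonneg ‖(k : G.pairSpace).snd‖]
  have hinner : ∀ k h : G.formSpace, inner ℂ k h =
      inner ℂ (ι k) (ι h) + G.form (ι k) (ι h) := by
    intro k h
    have hk := ((G.mem_formSpace_iff k).1 k.2).2
    have hh := ((G.mem_formSpace_iff h).1 h.2).2
    rw [Submodule.coe_inner, WithLp.prod_inner_apply, form_eq, lp.inner_eq_tsum]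
    congr 1
    exact tsum_congr fun p => by rw [hι, hι, ← hk, ← hh]; rfl
  have hlift : ∀ f ∈ G.formDomain, ∃ k : G.formSpace, ι k = f := by
    intro f hf
    refine ⟨⟨WithLp.toLp 2 (f, ⟨G.grad f, G.memlp_grad hf⟩), ?_⟩, rfl⟩
    rw [mem_formSpace_iff]
    exact ⟨hf, fun p => rfl⟩
  have hdom : ∀ k : G.formSpace, ι k ∈ G.formDomain :=
    fun k => ((G.mem_formSpace_iff k).1 k.2).1
  refine ⟨ι ∘L ContinuousLinearMap.adjoint ι, fun f u => ⟨fun h => ?_, fun h => ?_⟩,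
    ContinuousLinearMap.isPositive_self_comp_adjoint ι, ?_⟩
  · have h' : ι (ContinuousLinearMap.adjoint ι (u + f)) = f := h
    refine ⟨h' ▸ hdom _, fun g hg => ?_⟩
    obtain ⟨l, rfl⟩ := hlift g hg
    have h1 := hinner (ContinuousLinearMap.adjoint ι (u + f)) l
    rw [ContinuousLinearMap.adjoint_inner_left, h', inner_add_left, add_comm] at h1
    exact (add_left_cancel h1).symm
  · obtain ⟨k, hk⟩ := hlift f h.1
    have h1 : ContinuousLinearMap.adjoint ι (u + f) = k := by
      refine ext_inner_right ℂ fun l => ?_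
      rw [ContinuousLinearMap.adjoint_inner_left, hinner, hk, h.2 _ (hdom l), inner_add_left,
        add_comm]
    rw [ContinuousLinearMap.comp_apply, h1, hk]
  · refine (ContinuousLinearMap.opNorm_comp_le _ _).trans ?_
    rw [LinearIsometryEquiv.norm_map]
    nlinarith [norm_nonneg ι]

/-- The resolvent `(L + 1)⁻¹`: the bounded operator `R` on `ℓ²(V, m)` such that
`R (L f + f) = f` for `f ∈ D(L)`, and whose range is `D(L)`. -/
noncomputable def resolvent : G.l2 →L[ℂ] G.l2 := G.exists_resolvent.choose

theorem resolvent_apply_iff (f u : G.l2) : G.resolvent (u + f) = f ↔ G.IsLaplacian f u :=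
  G.exists_resolvent.choose_spec.1 f u

theorem resolvent_isPositive : G.resolvent.IsPositive := G.exists_resolvent.choose_spec.2.1

theorem norm_resolvent_le : ‖G.resolvent‖ ≤ 1 := G.exists_resolvent.choose_spec.2.2

theorem resolvent_isSelfAdjoint : IsSelfAdjoint G.resolvent := G.resolvent_isPositive.isSelfAdjoint

/-! ### The heat semigroup and the heat kernel -/

/-- The heat semigroup `e^{-tL}`, `t ≥ 0`, on `ℓ²(V, m)`. -/
noncomputable def heatSemigroup (t : ℝ) : G.l2 →L[ℂ] G.l2 :=
  expNegOfResolvent t G.resolvent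

/-- The `ℓ¹`-normalized delta function `δ_y`. -/
noncomputable def delta (y : V) : G.l2 :=
  indicatorConstLp 2 (MeasurableSet.singleton y)
    (by rw [measure_singleton]; exact ENNReal.ofReal_ne_top) ((1 / G.m y : ℝ) : ℂ)

/-- The heat kernel `p_t(x, y) = (e^{-tL} δ_y)(x)`, for `t ≥ 0`. -/
noncomputable def heatKernel (t : ℝ) (x y : V) : ℝ := (G.heatSemigroup t (G.delta y) x).re

end Discrete
end Analysis
end WeightedGraph

namespace WeightedGraph

/-! ### Formal Laplacian, radial functions and the geometry of balls and spheres. -/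

section Combinatorics

variable {V : Type*} (G : WeightedGraph V)

/-! The semigroup is reduced to resolvents: `e^{-tL}` is the norm limit of the implicit Euler scheme
`(1 + t/(n+1) L)^{-(n+1)}` (`tendsto_eulerOfResolvent_pow`). It therefore suffices to compare
iterated resolvents of the delta functions at the two roots, one resolvent at a time. A resolvent
solution solves `u + ε Lu = f` pointwise and is a form limit of finitely supported functions
(`isResolventSolution_euler`). These two facts give a minimum principle
(`IsFormApproximable.le_of_lap_le`) in which only the smaller function must lie in the form domain;
the larger one need only be nonnegative.

For stronger curvature growth, the model solution is a decreasing function of the radius.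
Transplanted to `G` it is a supersolution: by `lap_radial` the Laplacian of a radial function
involves only the two curvatures, and monotonicity makes both curvature inequalities act in the same
direction.

For weaker growth, transplanting the model solution would give a subsolution on `G`, but one not
known to lie in the form domain of `G`. Instead the solution on `G` is moved to the model: its
minimum over the ball of radius `r`, read as a function of the radius, is a nonnegative
supersolution there, while the model solution is in the form domain of the model. Comparing the
model with itself in this way also shows that its resolvents preserve nonnegative radially
decreasing functions, which both inductions require. -/

/-- The formal Laplacian `(1 / m(x)) ∑_y b(x, y) (u(x) - u(y))`. -/
noncomputable def lap (u : V → ℝ) (x : V) : ℝ :=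
  1 / G.m x * ∑ y ∈ (G.locallyFinite x).toFinset, G.b x y * (u x - u y)

/-- Allows every vertex of a finite set to be summed over one common finite set of neighbours, as
Green's formula needs. -/
theorem m_mul_lap_eq_sum (u : V → ℝ) {x : V} {B : Finset V} (hB : ∀ y, G.b x y ≠ 0 → y ∈ B) :
    G.m x * G.lap u x = ∑ y ∈ B, G.b x y * (u x - u y) := by
  rw [lap, ← mul_assoc, mul_one_div_cancel (G.m_pos x).ne', one_mul]
  refine Finset.sum_subset (fun y hy => hB y (by simpa using hy)) fun y _ hy => ?_
  have : G.b x y = 0 := by simpa using hy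
  rw [this, zero_mul]

theorem lap_mono {u v : V → ℝ} {x : V} (h : ∀ y, 0 < G.b x y → u x - u y ≤ v x - v y) :
    G.lap u x ≤ G.lap v x := by
  have hm := G.m_pos x
  refine mul_le_mul_of_nonneg_left (Finset.sum_le_sum fun y hy => ?_) (by positivity)
  have hb : 0 < G.b x y := lt_of_le_of_ne (G.b_nonneg x y) (Ne.symm (by simpa using hy))
  exact mul_le_mul_of_nonneg_left (h y hb) hb.le

theorem lap_sub (u v : V → ℝ) (x : V) :
    G.lap (fun y => u y - v y) x = G.lap u x - G.lap v x := by
  simp only [lap, ← mul_sub, ← Finset.sum_sub_distrib]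
  congr 1
  refine Finset.sum_congr rfl fun y _ => ?_
  ring

theorem graph_connected [Nonempty V] : G.graph.Connected where
  preconnected x y := by
    induction G.connected x y with
    | refl => rfl
    | tail _ h ih => exact ih.trans (SimpleGraph.Adj.reachable (G := G.graph) h)

theorem dist_self (x : V) : G.dist x x = 0 := SimpleGraph.dist_self

theorem eq_of_dist_eq_zero {x y : V} (h : G.dist x y = 0) : x = y := by
  have : Nonempty V := ⟨x⟩
  exact G.graph_connected.dist_eq_zero_iff.1 h

theorem dist_cases_of_adj (x₀ : V) {x y : V} (h : 0 < G.b x y) :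
    G.dist y x₀ = G.dist x x₀ ∨ G.dist y x₀ = G.dist x x₀ + 1 ∨ G.dist y x₀ + 1 = G.dist x x₀ := by
  have h1 : G.graph.Adj x y := h
  have h2 := h1.diff_dist_adj (u := x₀)
  have h3 := h1.symm.diff_dist_adj (u := x₀)
  simp only [dist, SimpleGraph.dist_comm (v := x₀)]
  lia

theorem curvature_sum_eq (x : V) (S : Set V) :
    ∑ᶠ y ∈ S, G.b x y = ∑ y ∈ (G.locallyFinite x).toFinset, S.indicator (G.b x) y := by
  rw [finsum_mem_def, finsum_eq_sum_of_support_subset]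
  intro y hy
  have : S.indicator (G.b x) y ≠ 0 := hy
  simpa using fun h : G.b x y = 0 => this (by simp [Set.indicator, h])

theorem outerCurvature_nonneg (x₀ x : V) : 0 ≤ G.outerCurvature x₀ x := by
  have hm := G.m_pos x
  exact mul_nonneg (by positivity)
    (finsum_nonneg fun y => finsum_nonneg fun _ => G.b_nonneg x y)

theorem innerCurvature_nonneg (x₀ x : V) : 0 ≤ G.innerCurvature x₀ x := by
  have hm := G.m_pos x
  exact mul_nonneg (by positivity)
    (finsum_nonneg fun y => finsum_nonneg fun _ => G.b_nonneg x y)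

/-- The formal Laplacian of a function of the distance to `x₀`. -/
theorem lap_radial (x₀ : V) (c : ℕ → ℝ) (x : V) :
    G.lap (fun y => c (G.dist y x₀)) x =
      G.outerCurvature x₀ x * (c (G.dist x x₀) - c (G.dist x x₀ + 1)) +
        G.innerCurvature x₀ x * (c (G.dist x x₀) - c (G.dist x x₀ - 1)) := by
  rw [lap, outerCurvature, innerCurvature, curvature_sum_eq, curvature_sum_eq, mul_assoc,
    mul_assoc, ← mul_add, Finset.sum_mul, Finset.sum_mul, ← Finset.sum_add_distrib]
  congr 1
  refine Finset.sum_congr rfl fun y hy => ?_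
  have hb : 0 < G.b x y := lt_of_le_of_ne (G.b_nonneg x y) (Ne.symm (by simpa using hy))
  simp only [Set.indicator, Set.mem_ofPred_eq]
  rcases G.dist_cases_of_adj x₀ hb with h | h | h
  -- Neighbours on the same sphere contribute nothing. At the root the truncated `0 - 1` is
  -- harmless: no neighbour falls under the inner case.
  · simp [h]
  · simp [h, add_assoc]
  · simp [← h, add_assoc]

theorem ball_finite (x₀ : V) (r : ℕ) : {x | G.dist x x₀ ≤ r}.Finite := by
  induction r with
  | zero =>
    refine (Set.finite_singleton x₀).subset fun x hx => ?_
    exact G.eq_of_dist_eq_zero (Nat.le_zero.1 hx)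
  | succ r ih =>
    refine (ih.union (ih.biUnion fun x _ => G.locallyFinite x)).subset fun x hx => ?_
    by_cases hr : G.dist x x₀ ≤ r
    · exact Or.inl hr
    right
    have : Nonempty V := ⟨x⟩
    have hx' : G.graph.dist x₀ x = r + 1 := by
      rw [SimpleGraph.dist_comm]
      exact le_antisymm hx (by simpa [dist] using hr)
    obtain ⟨p, hp⟩ := (G.graph_connected x x₀).exists_walk_length_eq_dist
    cases p with
    | nil => simp [dist_self] at hr
    | @cons _ y _ hadj q =>
      simp only [Set.mem_iUnion, Set.mem_ofPred_eq]
      refine ⟨y, ?_, ?_⟩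
      · have h1 := SimpleGraph.dist_le q
        rw [SimpleGraph.Walk.length_cons, SimpleGraph.dist_comm, hx'] at hp
        change G.graph.dist y x₀ ≤ r
        lia
      · have : 0 < G.b x y := hadj
        rw [G.b_symm]
        exact this.ne'

/-- An edge changes the distance to `x₀` by at most one, so a path cannot jump over an empty sphere.
The whole vertex set would then lie in a ball, which is finite. -/
theorem sphere_nonempty [Infinite V] (x₀ : V) (r : ℕ) : (G.sphere x₀ r).Nonempty := by
  cases r with
  | zero => exact ⟨x₀, G.dist_self x₀⟩
  | succ r =>
    by_contra hne
    rw [Set.not_nonempty_iff_eq_empty] at hne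
    suffices key : ∀ y, G.dist y x₀ ≤ r from
      Set.infinite_univ ((G.ball_finite x₀ r).subset fun y _ => key y)
    intro y
    induction G.connected x₀ y with
    | refl => simp [dist_self]
    | @tail z y _ h ih =>
      have h1 : G.dist y x₀ ≠ r + 1 := fun h1 => by
        have : y ∈ G.sphere x₀ (r + 1) := h1
        simp [hne] at this
      have := G.dist_cases_of_adj x₀ h
      lia

/-! ### The minimum principle -/

/-- `u` can be approximated in the form norm by finitely supported functions. -/
def IsFormApproximable (u : V → ℝ) : Prop :=
  ∀ δ : ℝ, 0 < δ → ∃ φ : V → ℝ, φ.support.Finite ∧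
    ∀ (A : Finset V) (F : Finset (V × V)),
      ∑ x ∈ A, G.m x * (u x - φ x) ^ 2 +
        1 / 2 * ∑ p ∈ F, G.b p.1 p.2 * ((u p.1 - φ p.1) - (u p.2 - φ p.2)) ^ 2 ≤ δ

theorem exists_finset_neighbors (A : Finset V) :
    ∃ B : Finset V, A ⊆ B ∧ ∀ x ∈ A, ∀ y, G.b x y ≠ 0 → y ∈ B := by
  classical
  refine ⟨A ∪ A.biUnion fun x => (G.locallyFinite x).toFinset, Finset.subset_union_left,
    fun x hx y hy => Finset.mem_union_right _ (Finset.mem_biUnion.2 ⟨x, hx, by simpa using hy⟩)⟩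

/-- Green's formula. -/
theorem sum_form_eq (h g : V → ℝ) {A B : Finset V} (hAB : A ⊆ B)
    (hg : ∀ x, x ∉ A → g x = 0) (hB : ∀ x ∈ A, ∀ y, G.b x y ≠ 0 → y ∈ B) :
    ∑ p ∈ B ×ˢ B, G.b p.1 p.2 * ((h p.1 - h p.2) * (g p.1 - g p.2)) =
      2 * ∑ x ∈ A, G.m x * (G.lap h x * g x) := by
  have h1 : ∑ x ∈ A, G.m x * (G.lap h x * g x) =
      ∑ x ∈ B, ∑ y ∈ B, G.b x y * (h x - h y) * g x := by
    rw [← Finset.sum_subset hAB fun x _ hx => by simp [hg x hx]]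
    refine Finset.sum_congr rfl fun x hx => ?_
    rw [← Finset.sum_mul, ← G.m_mul_lap_eq_sum h (hB x hx), mul_assoc]
  have h2 : ∑ x ∈ A, G.m x * (G.lap h x * g x) =
      ∑ x ∈ B, ∑ y ∈ B, G.b x y * (h y - h x) * g y := by
    rw [h1, Finset.sum_comm]
    refine Finset.sum_congr rfl fun x _ => Finset.sum_congr rfl fun y _ => ?_
    rw [G.b_symm]
  rw [two_mul]
  nth_rw 1 [h1]
  rw [h2, Finset.sum_product, ← Finset.sum_add_distrib]
  refine Finset.sum_congr rfl fun x _ => ?_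
  rw [← Finset.sum_add_distrib]
  refine Finset.sum_congr rfl fun y _ => ?_
  ring

/-- Young's inequality for `k * a⁺`, together with `a * a⁺ = (a⁺)²`. Here `k` plays the role of the
approximation error `u - φ`. -/
theorem max_zero_mul_ge (a k : ℝ) : (max a 0 ^ 2 - k ^ 2) / 2 ≤ (a + k) * max a 0 := by
  rcases le_total a 0 with h | h
  · rw [max_eq_right h]
    nlinarith [sq_nonneg k]
  · rw [max_eq_left h]
    nlinarith [sq_nonneg (a + k)]

/-- The counterpart of the previous bound for edge differences: the positive part is monotone and
1-Lipschitz, which gives `key`; Young's inequality absorbs `k`. -/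
theorem max_zero_sub_mul_ge (a a' k : ℝ) : ((max a 0 - max a' 0) ^ 2 - k ^ 2) / 2 ≤
    (a - a' + k) * (max a 0 - max a' 0) := by
  have key : (max a 0 - max a' 0) ^ 2 ≤ (a - a') * (max a 0 - max a' 0) := by
    rcases le_total a 0 with h | h <;> rcases le_total a' 0 with h' | h' <;>
      simp only [max_eq_right, max_eq_left, h, h'] <;> nlinarith
  nlinarith [sq_nonneg (max a 0 - max a' 0 + k)]

/-- The minimum principle: a subsolution in the form domain lies below any nonnegative
supersolution. -/
theorem IsFormApproximable.le_of_lap_le {u : V → ℝ} (hu : G.IsFormApproximable u) {w : V → ℝ}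
    (hw : ∀ x, 0 ≤ w x) {ε : ℝ} (hε : 0 < ε)
    (h : ∀ x, u x + ε * G.lap u x ≤ w x + ε * G.lap w x) (x : V) : u x ≤ w x := by
  classical
  have hm := G.m_pos
  -- The constant is `2(1 + ε) + 2`: twice the bound for `g²` plus twice the bound for `(u - φ)²`.
  have key : ∀ δ : ℝ, 0 < δ → u x - w x ≤ 0 ∨ G.m x * (u x - w x) ^ 2 ≤ (4 + 2 * ε) * δ := by
    intro δ hδ
    obtain ⟨φ, hφ, hφδ⟩ := hu δ hδ
    -- The natural test function `(u - w)⁺` need not have finite support. Replacing `u` by `φ` cures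
    -- this, since `w ≥ 0` makes `g` vanish wherever `φ` does.
    set g : V → ℝ := fun y => max (φ y - w y) 0 with hgdef
    have hg0 : ∀ y, 0 ≤ g y := fun y => le_max_right _ _
    -- The point `x` is inserted so that its single term can be read off from the sums over `A`.
    set A : Finset V := insert x hφ.toFinset with hA
    have hgA : ∀ y, y ∉ A → g y = 0 := by
      intro y hy
      have : φ y = 0 := by
        by_contra h0
        exact hy (Finset.mem_insert_of_mem (by simpa using h0))
      simp [hgdef, this, hw y]
    obtain ⟨B, hAB, hB⟩ := G.exists_finset_neighbors A
    have hgreen := G.sum_form_eq (fun y => u y - w y) g hAB hgA hB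
    have hneg : ∑ y ∈ A, G.m y * ((u y - w y) * g y) +
        ε * ∑ y ∈ A, G.m y * (G.lap (fun y => u y - w y) y * g y) ≤ 0 := by
      rw [Finset.mul_sum, ← Finset.sum_add_distrib]
      refine Finset.sum_nonpos fun y _ => ?_
      have h1 : u y - w y + ε * G.lap (fun y => u y - w y) y ≤ 0 := by
        rw [lap_sub]
        linarith [h y]
      have := mul_nonneg (hm y).le (hg0 y)
      nlinarith
    have hlow1 : ∑ y ∈ A, G.m y * (g y ^ 2 - (u y - φ y) ^ 2) / 2 ≤
        ∑ y ∈ A, G.m y * ((u y - w y) * g y) := by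
      refine Finset.sum_le_sum fun y _ => ?_
      rw [mul_div_assoc]
      refine mul_le_mul_of_nonneg_left ?_ (hm y).le
      have := max_zero_mul_ge (φ y - w y) (u y - φ y)
      rwa [show φ y - w y + (u y - φ y) = u y - w y by ring] at this
    have hlow2 : -(∑ p ∈ B ×ˢ B, G.b p.1 p.2 * ((u p.1 - φ p.1) - (u p.2 - φ p.2)) ^ 2) / 2 ≤
        ∑ p ∈ B ×ˢ B, G.b p.1 p.2 * (((u p.1 - w p.1) - (u p.2 - w p.2)) * (g p.1 - g p.2)) := by
      rw [neg_div, Finset.sum_div, ← Finset.sum_neg_distrib]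
      refine Finset.sum_le_sum fun p _ => ?_
      rw [mul_div_assoc, ← mul_neg]
      refine mul_le_mul_of_nonneg_left ?_ (G.b_nonneg _ _)
      have h1 := max_zero_sub_mul_ge (φ p.1 - w p.1) (φ p.2 - w p.2)
        ((u p.1 - φ p.1) - (u p.2 - φ p.2))
      have h2 : φ p.1 - w p.1 - (φ p.2 - w p.2) + (u p.1 - φ p.1 - (u p.2 - φ p.2)) =
        u p.1 - w p.1 - (u p.2 - w p.2) := by ring
      rw [h2] at h1
      have := sq_nonneg (max (φ p.1 - w p.1) 0 - max (φ p.2 - w p.2) 0)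
      simp only [hgdef]
      linarith
    have hb1 : ∑ y ∈ A, G.m y * (u y - φ y) ^ 2 ≤ δ := by
      have := hφδ A ∅
      simpa using this
    have hb2 : ∑ p ∈ B ×ˢ B, G.b p.1 p.2 * ((u p.1 - φ p.1) - (u p.2 - φ p.2)) ^ 2 ≤ 2 * δ := by
      have := hφδ ∅ (B ×ˢ B)
      simp only [Finset.sum_empty, zero_add] at this
      linarith
    have hsplit : ∑ y ∈ A, G.m y * (g y ^ 2 - (u y - φ y) ^ 2) / 2 =
        (∑ y ∈ A, G.m y * g y ^ 2 - ∑ y ∈ A, G.m y * (u y - φ y) ^ 2) / 2 := by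
      rw [← Finset.sum_sub_distrib, Finset.sum_div]
      exact Finset.sum_congr rfl fun y _ => by ring
    have hgsum : ∑ y ∈ A, G.m y * g y ^ 2 ≤ (1 + ε) * δ := by
      have h3 : 2 * (∑ y ∈ A, G.m y * (G.lap (fun y => u y - w y) y * g y)) ≥ -δ := by
        rw [← hgreen]
        linarith
      nlinarith
    have hxA : x ∈ A := Finset.mem_insert_self _ _
    have hgx : G.m x * g x ^ 2 ≤ (1 + ε) * δ :=
      (Finset.single_le_sum (f := fun y => G.m y * g y ^ 2)
        (fun y _ => mul_nonneg (hm y).le (sq_nonneg _)) hxA).trans hgsum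
    have hkx : G.m x * (u x - φ x) ^ 2 ≤ δ :=
      (Finset.single_le_sum (f := fun y => G.m y * (u y - φ y) ^ 2)
        (fun y _ => mul_nonneg (hm y).le (sq_nonneg _)) hxA).trans hb1
    by_cases h0 : u x - w x ≤ 0
    · exact Or.inl h0
    right
    push Not at h0
    have h4 : u x - w x ≤ g x + (u x - φ x) := by
      have : φ x - w x ≤ g x := le_max_left _ _
      linarith
    have h5 : (u x - w x) ^ 2 ≤ 2 * g x ^ 2 + 2 * (u x - φ x) ^ 2 := by
      have : (u x - w x) ^ 2 ≤ (g x + (u x - φ x)) ^ 2 := pow_le_pow_left₀ h0.le h4 2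
      nlinarith [sq_nonneg (g x - (u x - φ x))]
    have := mul_le_mul_of_nonneg_left h5 (hm x).le
    linarith
  by_contra hlt
  push Not at hlt
  have hpos : 0 < G.m x * (u x - w x) ^ 2 := mul_pos (hm x) (pow_pos (by linarith) 2)
  have hC : 0 < 2 * (4 + 2 * ε) := by positivity
  -- This `δ` turns the bound of `key` into half of the positive quantity being bounded.
  rcases key (G.m x * (u x - w x) ^ 2 / (2 * (4 + 2 * ε))) (by positivity) with h1 | h1
  · linarith
  · have : (4 + 2 * ε) * (G.m x * (u x - w x) ^ 2 / (2 * (4 + 2 * ε))) =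
        G.m x * (u x - w x) ^ 2 / 2 := by
      field_simp
    linarith

/-- `u = (1 + ε L)⁻¹ f`, expressed by real functions. -/
structure IsResolventSolution (ε : ℝ) (f u : V → ℝ) : Prop where
  approx : G.IsFormApproximable u
  eq : ∀ x, u x + ε * G.lap u x = f x

variable {G}

theorem IsFormApproximable.neg {u : V → ℝ} (hu : G.IsFormApproximable u) :
    G.IsFormApproximable fun x => -u x := by
  intro δ hδ
  obtain ⟨φ, hφ, h⟩ := hu δ hδ
  refine ⟨fun x => -φ x, by simpa [Function.support] using hφ, fun A F => ?_⟩
  convert h A F using 2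
  · exact Finset.sum_congr rfl fun x _ => by ring
  · congr 1
    exact Finset.sum_congr rfl fun x _ => by ring

theorem IsResolventSolution.nonneg {ε : ℝ} {f u : V → ℝ} (hu : G.IsResolventSolution ε f u)
    (hε : 0 < ε) (hf : ∀ x, 0 ≤ f x) (x : V) : 0 ≤ u x := by
  have h := hu.approx.neg.le_of_lap_le G (w := fun _ => 0) (fun _ => le_rfl) hε (fun y => ?_) x
  · simpa using h
  · have h1 : G.lap (fun x => -u x) y = -G.lap u y := by
      have := G.lap_sub (fun _ => 0) u y
      simpa [lap] using this
    have h2 : G.lap (fun _ => 0) y = 0 := by simp [lap]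
    rw [h1, h2]
    linarith [hu.eq y, hf y]

/-! ### Comparison of resolvent solutions. -/

variable {W : Type*} {Gsym : WeightedGraph W} {x₀ : V} {o : W}

/-- Weaker curvature growth: the resolvent solution lies above that of the model. -/
theorem HasWeakerCurvatureGrowth.resolvent_le (hG : G.HasWeakerCurvatureGrowth x₀ Gsym o)
    {ε : ℝ} (hε : 0 < ε) {f u : V → ℝ} {v : W → ℝ} {g : ℕ → ℝ} (hg : Antitone g)
    (hg0 : ∀ r, 0 ≤ g r) (hfg : ∀ x, g (G.dist x x₀) ≤ f x)
    (hu : G.IsResolventSolution ε f u)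
    (hv : Gsym.IsResolventSolution ε (fun y => g (Gsym.dist y o)) v)
    {x : V} {y : W} (hxy : G.dist x x₀ ≤ Gsym.dist y o) : v y ≤ u x := by
  have hu0 : ∀ x, 0 ≤ u x := hu.nonneg hε fun x => (hg0 _).trans (hfg x)
  -- `z r` minimises `u` over the ball, not the sphere, of radius `r`; this makes `r ↦ u (z r)`
  -- decreasing with no further argument.
  have hz : ∀ r, ∃ z, G.dist z x₀ ≤ r ∧ ∀ x, G.dist x x₀ ≤ r → u z ≤ u x := fun r => by
    obtain ⟨z, hz, h⟩ := Set.exists_min_image _ u (G.ball_finite x₀ r) ⟨x₀, by simp [dist_self]⟩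
    exact ⟨z, hz, h⟩
  choose z hzr hz using hz
  have hanti : Antitone fun r => u (z r) := fun r s hrs => hz s _ ((hzr r).trans hrs)
  refine le_trans ?_ (hz (Gsym.dist y o) x hxy)
  -- The minimum principle is applied on the model, where `v` is known to be form approximable.
  refine hv.approx.le_of_lap_le Gsym (w := fun y => u (z (Gsym.dist y o))) (fun _ => hu0 _) hε
    (fun y => ?_) y
  rw [hv.eq, Gsym.lap_radial o (fun r => u (z r)) y]
  set r := Gsym.dist y o with hr
  have hx := hu.eq (z r)
  -- The minimiser over the `r`-ball may lie on an inner sphere `s`. It is then minimal over the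
  -- `s`-ball too.
  set s := G.dist (z r) x₀ with hs
  have hsr : s ≤ r := hzr r
  have hus : u (z s) = u (z r) := le_antisymm (hz s _ le_rfl) (hanti hsr)
  -- The radial function of ball minima lies below `u` and touches it at `z r`, which orders the
  -- Laplacians there.
  have hlap : G.lap u (z r) ≤ G.lap (fun x => u (z (G.dist x x₀))) (z r) := by
    refine G.lap_mono fun y _ => ?_
    rw [← hs, hus]
    linarith [hz (G.dist y x₀) y le_rfl]
  rw [G.lap_radial x₀ (fun r => u (z r)) (z r), ← hs, hus] at hlap
  have hgf : g r ≤ f (z r) := (hg hsr).trans (hfg _)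
  have hout : u (z (r + 1)) ≤ u (z r) := hanti (Nat.le_succ r)
  have hin : u (z r) ≤ u (z (r - 1)) := hanti (Nat.sub_le r 1)
  -- If `s = r`, the curvatures at `z r` and `y` are comparable. If `s < r`, the ball minimum is
  -- constant on radii from `s` to `r`: the inner term at `y` vanishes, the outer one is
  -- nonnegative, and `lap u (z r) ≤ 0`, so no curvature comparison is needed.
  rcases hsr.eq_or_lt with hsr | hsr
  · obtain ⟨hc1, hc2⟩ := hG.2 r (z r) (by exact hsr) y rfl
    rw [hsr] at hlap
    have h1 := mul_le_mul_of_nonneg_right hc1 (sub_nonneg.2 hout)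
    have h2 := mul_le_mul_of_nonneg_right hc2 (sub_nonneg.2 hin)
    have h3 : G.lap u (z r) ≤ Gsym.outerCurvature o y * (u (z r) - u (z (r + 1))) +
        Gsym.innerCurvature o y * (u (z r) - u (z (r - 1))) := by linarith
    have := mul_le_mul_of_nonneg_left h3 hε.le
    linarith
  · have h1 : u (z (s + 1)) = u (z r) :=
      le_antisymm (hus ▸ hanti (Nat.le_succ s)) (hanti (Nat.succ_le_of_lt hsr))
    have h2 : u (z (r - 1)) = u (z r) :=
      le_antisymm (hus ▸ hanti (Nat.le_sub_one_of_lt hsr)) hin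
    have h3 : u (z r) ≤ u (z (s - 1)) := hus ▸ hanti (Nat.sub_le s 1)
    rw [h1, sub_self, mul_zero, zero_add] at hlap
    have h4 := mul_nonneg (G.innerCurvature_nonneg x₀ (z r)) (sub_nonneg.2 h3)
    have h5 := mul_nonneg (Gsym.outerCurvature_nonneg o y) (sub_nonneg.2 hout)
    rw [h2, sub_self, mul_zero, add_zero]
    have h6 : G.lap u (z r) ≤ 0 := by linarith
    have h7 := mul_nonneg hε.le h5
    nlinarith

/-- Makes self-comparison possible, from which the symmetry and monotonicity of the model's
resolvent solutions follow. -/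
theorem IsWeaklySphericallySymmetric.hasWeakerCurvatureGrowth
    (h : G.IsWeaklySphericallySymmetric x₀) : G.HasWeakerCurvatureGrowth x₀ G x₀ := by
  obtain ⟨⟨c, hc⟩, ⟨d, hd⟩⟩ := h
  refine ⟨rfl, fun r x hx y hy => ?_⟩
  rw [hc r x hx, hc r y hy, hd r x hx, hd r y hy]
  exact ⟨le_rfl, le_rfl⟩

/-- On a weakly spherically symmetric graph, resolvent solutions with radially decreasing
nonnegative right hand side are radially decreasing and nonnegative. -/
theorem IsWeaklySphericallySymmetric.exists_antitone [Infinite V]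
    (h : G.IsWeaklySphericallySymmetric x₀) {ε : ℝ} (hε : 0 < ε) {g : ℕ → ℝ} (hg : Antitone g)
    (hg0 : ∀ r, 0 ≤ g r) {v : V → ℝ}
    (hv : G.IsResolventSolution ε (fun y => g (G.dist y x₀)) v) :
    ∃ c : ℕ → ℝ, Antitone c ∧ (∀ r, 0 ≤ c r) ∧ v = fun y => c (G.dist y x₀) := by
  -- Comparing `v` with itself gives monotonicity in the radius; applied both ways to points at
  -- equal distance, it also gives radial symmetry.
  have key : ∀ x y, G.dist x x₀ ≤ G.dist y x₀ → v y ≤ v x := fun x y hxy =>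
    h.hasWeakerCurvatureGrowth.resolvent_le hε hg hg0 (fun _ => le_rfl) hv hv hxy
  choose z hz using G.sphere_nonempty x₀
  have hz' : ∀ r, G.dist (z r) x₀ = r := hz
  refine ⟨fun r => v (z r), fun r s hrs => key _ _ (by rwa [hz', hz']),
    fun r => hv.nonneg hε (fun _ => hg0 _) _, funext fun y => le_antisymm (key _ _ ?_) (key _ _ ?_)⟩
  · rw [hz']
  · rw [hz']

/-- Stronger curvature growth: the resolvent solution lies below that of the model. -/
theorem HasStrongerCurvatureGrowth.resolvent_le [Infinite W]
    (hG : G.HasStrongerCurvatureGrowth x₀ Gsym o)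
    {ε : ℝ} (hε : 0 < ε) {f u : V → ℝ} {g c : ℕ → ℝ} (hc : Antitone c)
    (hc0 : ∀ r, 0 ≤ c r) (hfg : ∀ x, f x ≤ g (G.dist x x₀))
    (hu : G.IsResolventSolution ε f u)
    (hv : Gsym.IsResolventSolution ε (fun y => g (Gsym.dist y o)) fun y => c (Gsym.dist y o))
    (x : V) : u x ≤ c (G.dist x x₀) := by
  refine hu.approx.le_of_lap_le G (w := fun x => c (G.dist x x₀)) (fun _ => hc0 _) hε
    (fun x => ?_) x
  obtain ⟨y, hy⟩ := Gsym.sphere_nonempty o (G.dist x x₀)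
  have hy' : Gsym.dist y o = G.dist x x₀ := hy
  have h1 := hv.eq y
  rw [lap_radial, hy'] at h1
  rw [hu.eq, lap_radial]
  refine (hfg x).trans ?_
  rw [← h1]
  -- As `c` decreases, the outer difference is nonnegative and the inner one nonpositive, so a
  -- larger outer and a smaller inner curvature both increase the Laplacian.
  obtain ⟨hc1, hc2⟩ := hG.2 _ x rfl y hy
  have h2 := mul_le_mul_of_nonneg_right hc1 (sub_nonneg.2 (hc (Nat.le_succ (G.dist x x₀))))
  have h3 := mul_le_mul_of_nonneg_right hc2 (sub_nonneg.2 (hc (Nat.sub_le (G.dist x x₀) 1)))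
  simp only [Nat.succ_eq_add_one] at h2
  refine add_le_add_right (mul_le_mul_of_nonneg_left ?_ hε.le) _
  linarith

end Combinatorics
end WeightedGraph

/-! ### Scalar estimates for the implicit Euler scheme. -/

/-- The function of `1 / (λ + 1)` that represents `(1 + ε λ)⁻¹`. -/
noncomputable def eulerSymbol (ε s : ℝ) : ℝ := s / (s + ε * (1 - s))

theorem eulerSymbol_denom_pos {ε : ℝ} (hε : 0 < ε) {s : ℝ} (hs : s ∈ Set.Icc (0 : ℝ) 1) :
    0 < s + ε * (1 - s) := by
  rcases hs.1.eq_or_lt with h | h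
  · rw [← h]
    linarith
  · have := mul_nonneg hε.le (sub_nonneg.2 hs.2)
    linarith

theorem continuousOn_eulerSymbol {ε : ℝ} (hε : 0 < ε) :
    ContinuousOn (eulerSymbol ε) (Set.Icc 0 1) := by
  unfold eulerSymbol
  exact continuousOn_id.div (by fun_prop) fun s hs => (eulerSymbol_denom_pos hε hs).ne'

/-- The binomial expansion cut off after the quadratic term. That term cancels the `y²` in the Euler
error and leaves a bound uniform in `y`. -/
theorem one_add_mul_add_choose_le_pow {y : ℝ} (hy : 0 ≤ y) (n : ℕ) :
    1 + n * y + n * (n - 1) / 2 * y ^ 2 ≤ (1 + y) ^ n := by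
  induction n with
  | zero => simp
  | succ n ih =>
    rw [pow_succ]
    refine le_trans ?_ (mul_le_mul_of_nonneg_right ih (by linarith))
    push_cast
    have h : (0 : ℝ) ≤ n * (n - 1) := by
      rcases n with _ | n
      · simp
      · push_cast
        rw [add_sub_cancel_right]
        positivity
    have := mul_nonneg h (pow_nonneg hy 3)
    nlinarith

/-- Uniform convergence of the implicit Euler scheme, for scalars. -/
theorem abs_inv_one_add_pow_sub_exp_le {y : ℝ} (hy : 0 ≤ y) (n : ℕ) :
    n * |(1 / (1 + y)) ^ (n + 1) - Real.exp (-((n + 1) * y))| ≤ 2 := by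
  have h1 : 0 < 1 + y := by linarith
  set a := 1 / (1 + y) with ha
  have ha0 : 0 < a := by positivity
  have hexp : Real.exp (-((n + 1) * y)) = Real.exp (-y) ^ (n + 1) := by
    rw [← Real.exp_nat_mul]
    congr 1
    push_cast
    ring
  have hba : Real.exp (-y) ≤ a := by
    rw [ha, Real.exp_neg, ← one_div]
    exact one_div_le_one_div_of_le h1 (by linarith [Real.add_one_le_exp y])
  have hle : Real.exp (-y) ^ (n + 1) ≤ a ^ (n + 1) := pow_le_pow_left₀ (Real.exp_pos _).le hba _
  have hapos : 0 < a ^ (n + 1) := by positivity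
  -- For `y ≤ 1`, `a (1 - y²) = 1 - y ≤ e^{-y}`, and Bernoulli's inequality applies to `(1 -
  -- y²)^(n+1)`. For `y ≥ 1` the left side is nonpositive.
  have hge : a ^ (n + 1) * (1 - (n + 1) * y ^ 2) ≤ Real.exp (-y) ^ (n + 1) := by
    rcases le_total 1 y with h | h
    · refine le_trans (mul_nonpos_of_nonneg_of_nonpos hapos.le ?_) (by positivity)
      have : (0 : ℝ) ≤ n * y ^ 2 := by positivity
      nlinarith
    · have hb : a * (1 - y ^ 2) ≤ Real.exp (-y) := by
        have : a * (1 - y ^ 2) = 1 - y := by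
          rw [ha]
          field_simp
          ring
        rw [this]
        linarith [Real.add_one_le_exp (-y)]
      have hy2 : 0 ≤ 1 - y ^ 2 := by nlinarith
      refine le_trans ?_ (pow_le_pow_left₀ (mul_nonneg ha0.le hy2) hb _)
      rw [mul_pow]
      refine mul_le_mul_of_nonneg_left ?_ hapos.le
      have := one_add_mul_le_pow (a := -y ^ 2) (by nlinarith) (n + 1)
      push_cast at this
      rw [← sub_eq_add_neg] at this
      linarith
  rw [hexp, abs_of_nonneg (sub_nonneg.2 hle)]
  have hprod : a ^ (n + 1) * (1 + y) ^ (n + 1) = 1 := by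
    rw [← mul_pow, ha, one_div_mul_cancel h1.ne', one_pow]
  have h2 := one_add_mul_add_choose_le_pow hy (n + 1)
  push_cast at h2
  -- Multiplied by `a^(n+1) = (1 + y)^{-(n+1)}`, this bounds `n` times the error by `2`.
  have h3 : (n : ℝ) * (n + 1) * y ^ 2 ≤ 2 * (1 + y) ^ (n + 1) := by
    have : (0 : ℝ) ≤ (n + 1) * y := by positivity
    nlinarith
  have h4 := mul_le_mul_of_nonneg_left h3 hapos.le
  have h5 : (n : ℝ) * (a ^ (n + 1) - Real.exp (-y) ^ (n + 1)) ≤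
      n * (a ^ (n + 1) * ((n + 1) * y ^ 2)) := by
    refine mul_le_mul_of_nonneg_left ?_ (Nat.cast_nonneg n)
    linarith
  nlinarith

/-- The scalar estimate at `y = t λ / (n+1)` with `λ = 1/s - 1`. At `s = 0`, that is `λ = ∞`, both
symbols vanish because `t > 0`. -/
theorem eulerSymbol_pow_sub_heatSymbol_le {t : ℝ} (ht : 0 < t) (n : ℕ) {s : ℝ}
    (hs : s ∈ Set.Icc (0 : ℝ) 1) :
    n * |eulerSymbol (t / (n + 1)) s ^ (n + 1) - heatSymbol t s| ≤ 2 := by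
  rcases hs.1.eq_or_lt with h | h
  · simp [eulerSymbol, heatSymbol, ← h, ht.ne']
  · have hx : 0 ≤ 1 / s - 1 := sub_nonneg.2 ((one_le_div h).2 hs.2)
    convert abs_inv_one_add_pow_sub_exp_le (y := t / (n + 1) * (1 / s - 1)) (by positivity) n
      using 4
    · rw [eulerSymbol]
      congr 1
      have hd := eulerSymbol_denom_pos (ε := t / (n + 1)) (by positivity) hs
      have hd' : 1 + t / (n + 1) * (1 / s - 1) = (s + t / (n + 1) * (1 - s)) / s := by
        field_simp
      rw [hd', one_div_div]
    · rw [heatSymbol, if_neg h.ne']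
      congr 2
      field_simp

/-! ### Functional calculus of the resolvent. -/

section Operators

variable {H : Type*} [NormedAddCommGroup H] [InnerProductSpace ℂ H] [CompleteSpace H]
  {R : H →L[ℂ] H}

/-- The operator `(1 + ε L)⁻¹`, as a function of `R = (1 + L)⁻¹`. -/
noncomputable def eulerOfResolvent (ε : ℝ) (R : H →L[ℂ] H) : H →L[ℂ] H := cfc (eulerSymbol ε) R

theorem isSelfAdjoint_expNegOfResolvent (t : ℝ) (R : H →L[ℂ] H) :
    IsSelfAdjoint (expNegOfResolvent t R) := IsSelfAdjoint.cfc

/-- The implicit Euler scheme converges in norm to the heat semigroup. -/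
theorem tendsto_eulerOfResolvent_pow (hR : R.IsPositive) (hn : ‖R‖ ≤ 1) {t : ℝ} (ht : 0 < t) :
    Filter.Tendsto (fun n : ℕ => eulerOfResolvent (t / (n + 1)) R ^ (n + 1)) Filter.atTop
      (nhds (expNegOfResolvent t R)) := by
  have hsa : IsSelfAdjoint R := hR.isSelfAdjoint
  have hsp := spectrum_subset_Icc hR hn
  have hcont : ∀ n : ℕ, ContinuousOn (eulerSymbol (t / (n + 1))) (spectrum ℝ R) := fun n =>
    (continuousOn_eulerSymbol (by positivity)).mono hsp
  have h : ∀ n : ℕ, eulerOfResolvent (t / (n + 1)) R ^ (n + 1) =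
      cfc (fun s => eulerSymbol (t / (n + 1)) s ^ (n + 1)) R := fun n =>
    (cfc_pow _ _ R (hcont n) hsa).symm
  simp only [h]
  refine tendsto_cfc_fun ?_ (Filter.Eventually.of_forall fun n => (hcont n).pow _)
  rw [Metric.tendstoUniformlyOn_iff]
  intro δ hδ
  obtain ⟨N, hN⟩ := exists_nat_gt (2 / δ)
  filter_upwards [Filter.eventually_ge_atTop N] with n hNn s hs
  have h1 := eulerSymbol_pow_sub_heatSymbol_le ht n (hsp hs)
  have h2 : 2 / δ < n := hN.trans_le (by exact_mod_cast hNn)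
  rw [dist_comm, Real.dist_eq]
  rw [div_lt_iff₀ hδ] at h2
  have hn0 : (0 : ℝ) < n := by
    by_contra hc
    have : (n : ℝ) = 0 := le_antisymm (not_lt.1 hc) (Nat.cast_nonneg n)
    rw [this] at h2
    linarith
  exact lt_of_mul_lt_mul_left (h1.trans_lt h2) hn0.le

/-- The functional calculus realizes `(1 + ε L)⁻¹` in terms of `R = (1 + L)⁻¹`. -/
theorem exists_eulerOfResolvent_eq (hR : R.IsPositive) (hn : ‖R‖ ≤ 1) {ε : ℝ} (hε : 0 < ε) :
    ∃ K : H →L[ℂ] H, ∀ f, eulerOfResolvent ε R f = R (K f) ∧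
      ε • K f + (1 - ε) • R (K f) = f := by
  have hsa : IsSelfAdjoint R := hR.isSelfAdjoint
  have hsp := spectrum_subset_Icc hR hn
  -- In terms of `λ = 1/s - 1` this function is `(λ + 1) / (1 + ελ)`, so `K` represents `(L + 1)(1 +
  -- εL)⁻¹`.
  have hk : ContinuousOn (fun s : ℝ => (s + ε * (1 - s))⁻¹) (spectrum ℝ R) :=
    (ContinuousOn.inv₀ (by fun_prop) fun s hs => (eulerSymbol_denom_pos hε hs).ne').mono hsp
  have h1 : eulerOfResolvent ε R = R * cfc (fun s : ℝ => (s + ε * (1 - s))⁻¹) R := by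
    have := cfc_mul (fun s : ℝ => s) (fun s : ℝ => (s + ε * (1 - s))⁻¹) R (by fun_prop) hk
    rw [cfc_id' ℝ R hsa] at this
    exact this
  have h2 : ε • cfc (fun s : ℝ => (s + ε * (1 - s))⁻¹) R +
      (1 - ε) • (R * cfc (fun s : ℝ => (s + ε * (1 - s))⁻¹) R) = 1 := by
    rw [← h1, eulerOfResolvent, ← cfc_const_mul ε _ R hk,
      ← cfc_const_mul (1 - ε) _ R ((continuousOn_eulerSymbol hε).mono hsp),
      ← cfc_add R _ _ (hk.const_mul _)
        (((continuousOn_eulerSymbol hε).mono hsp).const_mul _), ← cfc_const_one ℝ R hsa]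
    refine cfc_congr fun s hs => ?_
    have := (eulerSymbol_denom_pos hε (hsp hs)).ne'
    simp only [eulerSymbol]
    field_simp
    ring
  refine ⟨cfc (fun s : ℝ => (s + ε * (1 - s))⁻¹) R, fun f => ⟨by rw [h1]; rfl, ?_⟩⟩
  have := congrArg (fun T : H →L[ℂ] H => T f) h2
  simpa using this

theorem expNegOfResolvent_zero (hR : R.IsPositive) : expNegOfResolvent 0 R = 1 := by
  have h : heatSymbol 0 = fun _ => 1 := by
    funext s
    simp [heatSymbol]
  rw [expNegOfResolvent, h, cfc_const_one ℝ R hR.isSelfAdjoint]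

end Operators

/-! ### From operators on `ℓ²(V, m)` to pointwise statements for real functions. -/

namespace WeightedGraph

variable {V : Type*} [MeasurableSpace V] (G : WeightedGraph V)

theorem ofReal_mul_sq_le (c : ℝ) (hc : 0 ≤ c) (z : ℂ) :
    ENNReal.ofReal (c * z.re ^ 2) ≤ ENNReal.ofReal c * ‖z‖ₑ ^ 2 := by
  rw [ENNReal.ofReal_mul hc]
  gcongr
  rw [← ofReal_norm, ← ENNReal.ofReal_pow (norm_nonneg _)]
  refine ENNReal.ofReal_le_ofReal ?_
  rw [← sq_abs]
  exact pow_le_pow_left₀ (abs_nonneg _) (Complex.abs_re_le_norm z) 2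

/-- Passing to real parts does not increase the form norm, so the real parts of the approximants
serve. -/
theorem isFormApproximable_re {f : G.l2} (hf : f ∈ G.formDomain) :
    G.IsFormApproximable fun x => (f x).re := by
  intro δ hδ
  obtain ⟨φ, hφ, hlt⟩ := hf (ENNReal.ofReal δ) (by simpa using hδ)
  refine ⟨fun x => (φ x).re, hφ.subset fun x hx h => hx (by simp [h]), fun A F => ?_⟩
  have hm := fun x => (G.m_pos x).le
  have hb := G.b_nonneg
  rw [← ENNReal.ofReal_le_ofReal_iff hδ.le]
  refine le_trans ?_ hlt.le
  rw [ENNReal.ofReal_add (Finset.sum_nonneg fun x _ => mul_nonneg (hm x) (sq_nonneg _))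
    (mul_nonneg (by norm_num) (Finset.sum_nonneg fun p _ => mul_nonneg (hb _ _) (sq_nonneg _))),
    ENNReal.ofReal_mul (by norm_num),
    ENNReal.ofReal_sum_of_nonneg fun x _ => mul_nonneg (hm x) (sq_nonneg _),
    ENNReal.ofReal_sum_of_nonneg fun p _ => mul_nonneg (hb _ _) (sq_nonneg _), formNormSq]
  have h2 : ENNReal.ofReal (1 / 2) = 2⁻¹ := by
    rw [one_div, ENNReal.ofReal_inv_of_pos two_pos]
    simp
  rw [h2]
  gcongr
  · refine (Finset.sum_le_sum fun x _ => ?_).trans (ENNReal.sum_le_tsum A)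
    simpa using ofReal_mul_sq_le (G.m x) (hm x) (f x - φ x)
  · refine (Finset.sum_le_sum fun p _ => ?_).trans (ENNReal.sum_le_tsum F)
    simpa using ofReal_mul_sq_le (G.b p.1 p.2) (hb _ _) ((f p.1 - φ p.1) - (f p.2 - φ p.2))

variable [Countable V] [DiscreteMeasurableSpace V]

open Classical in
theorem delta_apply (y x : V) : G.delta y x = if x = y then ((1 / G.m y : ℝ) : ℂ) else 0 := by
  have h := G.ae_measure_iff.1 (indicatorConstLp_coeFn (p := 2) (μ := G.measure)
    (hs := MeasurableSet.singleton y) (hμs := by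
      rw [measure_singleton]; exact ENNReal.ofReal_ne_top) (c := ((1 / G.m y : ℝ) : ℂ))) x
  rw [delta, h]
  simp [Set.indicator]

theorem inner_delta (x : V) (f : G.l2) : inner ℂ (G.delta x) f = f x := by
  have hm := G.m_pos x
  rw [delta, L2.inner_indicatorConstLp_eq_inner_setIntegral, integral_singleton, Measure.real,
    measure_singleton, ENNReal.toReal_ofReal hm.le]
  have : (G.m x : ℂ) ≠ 0 := by exact_mod_cast hm.ne'
  simp only [RCLike.inner_apply, Complex.conj_ofReal, Complex.real_smul]
  push_cast
  field_simp

theorem delta_mem_formDomain (x : V) : G.delta x ∈ G.formDomain := by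
  intro ε hε
  refine ⟨G.delta x, (Set.finite_singleton x).subset fun y hy => ?_, by simpa [formNormSq] using hε⟩
  by_contra h
  exact hy (by rw [delta_apply, if_neg (by simpa using h)])

/-- Turns the weak equation into a pointwise one. By local finiteness the sum is finite, so Green's
formula applies to arbitrary `f`. -/
theorem re_form_delta (f : V → ℂ) (x : V) :
    (G.form f (G.delta x)).re = G.lap (fun y => (f y).re) x := by
  classical
  obtain ⟨B, hAB, hB⟩ := G.exists_finset_neighbors {x}
  have hd : ∀ y, G.delta x y = (((if y = x then 1 / G.m x else 0 : ℝ)) : ℂ) := fun y => by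
    rw [delta_apply]
    split_ifs <;> simp
  have hsupp : ∀ p ∉ B ×ˢ B, (G.b p.1 p.2 : ℂ) *
      (conj (f p.1 - f p.2) * (G.delta x p.1 - G.delta x p.2)) = 0 := by
    rintro ⟨y, z⟩ hp
    by_cases hb : G.b y z = 0
    · simp [hb]
    have hxB : x ∈ B := hAB (Finset.mem_singleton_self x)
    have hy : y ≠ x := by
      rintro rfl
      exact hp (Finset.mem_product.2 ⟨hxB, hB y (by simp) z hb⟩)
    have hz : z ≠ x := by
      rintro rfl
      exact hp (Finset.mem_product.2 ⟨hB z (by simp) y (by rwa [G.b_symm]), hxB⟩)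
    simp [hd, hy, hz]
  have hgreen := G.sum_form_eq (fun y => (f y).re) (fun y => if y = x then 1 / G.m x else 0)
    hAB (fun y hy => if_neg (by simpa using hy)) hB
  rw [form, tsum_eq_sum hsupp]
  have hm := (G.m_pos x).ne'
  have hre : (1 / 2 * ∑ p ∈ B ×ˢ B, (G.b p.1 p.2 : ℂ) *
      (conj (f p.1 - f p.2) * (G.delta x p.1 - G.delta x p.2))).re =
      1 / 2 * ∑ p ∈ B ×ˢ B, G.b p.1 p.2 * (((f p.1).re - (f p.2).re) *
        ((if p.1 = x then 1 / G.m x else 0) - if p.2 = x then 1 / G.m x else 0)) := by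
    rw [show (1 / 2 : ℂ) = ((1 / 2 : ℝ) : ℂ) by push_cast; rfl, Complex.re_ofReal_mul,
      Complex.re_sum]
    congr 1
    refine Finset.sum_congr rfl fun p _ => ?_
    rw [hd, hd, Complex.re_ofReal_mul, ← Complex.ofReal_sub, Complex.re_mul_ofReal]
    simp
  rw [hre, hgreen]
  simp
  field_simp

/-- The operator `(1 + ε L)⁻¹`. -/
noncomputable def euler (ε : ℝ) : G.l2 →L[ℂ] G.l2 := eulerOfResolvent ε G.resolvent

/-- Writing `(1 + εL)⁻¹ f = R (K f)` places it in `D(L)` with image `K f - (1 + εL)⁻¹ f`; testing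
against delta functions yields the equation at each vertex. -/
theorem isResolventSolution_euler {ε : ℝ} (hε : 0 < ε) (f : G.l2) :
    G.IsResolventSolution ε (fun x => (f x).re) fun x => (G.euler ε f x).re := by
  obtain ⟨K, hK⟩ := exists_eulerOfResolvent_eq G.resolvent_isPositive G.norm_resolvent_le hε
  obtain ⟨h1, h2⟩ := hK f
  have hL : G.IsLaplacian (G.euler ε f) (K f - G.euler ε f) := by
    rw [← resolvent_apply_iff, sub_add_cancel, euler, h1]
  refine ⟨G.isFormApproximable_re hL.1, fun x => ?_⟩
  have h3 := congrArg Complex.re (hL.2 _ (G.delta_mem_formDomain x))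
  rw [re_form_delta, ← inner_conj_symm, inner_delta, Complex.conj_re, coe_sub_apply,
    Complex.sub_re] at h3
  rw [h3]
  rw [← h1, ← euler] at h2
  have h4 : f x = ε * K f x + (1 - ε : ℝ) * G.euler ε f x := by
    conv_lhs => rw [← h2]
    rw [coe_add_apply, ← Complex.coe_smul, ← Complex.coe_smul, coe_smul_apply, coe_smul_apply]
  rw [h4, Complex.add_re, Complex.re_ofReal_mul, Complex.re_ofReal_mul]
  ring

/-- Self-adjointness of the semigroup. It moves the root to the second argument, where the iterates
start from its delta function. -/
theorem heatKernel_symm (t : ℝ) (x y : V) : G.heatKernel t x y = G.heatKernel t y x := by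
  have hsa : IsSelfAdjoint (G.heatSemigroup t) := isSelfAdjoint_expNegOfResolvent _ _
  rw [heatKernel, heatKernel, ← inner_delta, ← inner_delta, ← inner_conj_symm, Complex.conj_re,
    ← ContinuousLinearMap.adjoint_inner_right, hsa.adjoint_eq]

theorem tendsto_euler_pow_delta {t : ℝ} (ht : 0 < t) (x y : V) :
    Filter.Tendsto (fun n : ℕ => ((G.euler (t / (n + 1)) ^ (n + 1)) (G.delta y) x).re)
      Filter.atTop (nhds (G.heatKernel t x y)) := by
  have h := tendsto_eulerOfResolvent_pow G.resolvent_isPositive G.norm_resolvent_le ht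
  have hc : Continuous fun T : G.l2 →L[ℂ] G.l2 => (T (G.delta y) x).re :=
    Complex.continuous_re.comp ((G.continuous_coe_apply x).comp
      (ContinuousLinearMap.apply ℂ G.l2 (G.delta y)).continuous)
  exact (hc.tendsto _).comp h

theorem re_delta_eq (x₀ x : V) :
    (G.delta x₀ x).re = if G.dist x x₀ = 0 then 1 / G.m x₀ else 0 := by
  rw [delta_apply]
  by_cases h : x = x₀
  · rw [if_pos h, if_pos (by rw [h, dist_self]), Complex.ofReal_re]
  · rw [if_neg h, if_neg fun h0 => h (G.eq_of_dist_eq_zero h0), Complex.zero_re]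

theorem heatKernel_zero (x x₀ : V) :
    G.heatKernel 0 x x₀ = if G.dist x x₀ = 0 then 1 / G.m x₀ else 0 := by
  rw [heatKernel, heatSemigroup, expNegOfResolvent_zero G.resolvent_isPositive, ← re_delta_eq]
  rfl

theorem antitone_dirac {m : ℝ} (hm : 0 < m) :
    Antitone (fun r : ℕ => if r = 0 then 1 / m else 0) ∧
      ∀ r : ℕ, 0 ≤ (if r = 0 then 1 / m else 0) := by
  have h0 : ∀ r : ℕ, 0 ≤ (if r = 0 then 1 / m else 0) := fun r => by
    split_ifs <;> positivity
  refine ⟨fun r s hrs => ?_, h0⟩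
  rcases Nat.eq_zero_or_pos s with rfl | hs
  · simp [Nat.le_zero.1 hrs]
  · simpa [hs.ne'] using h0 r

/-! ### Comparison of iterated resolvents and of heat kernels. -/

variable {G}

/-- On a weakly spherically symmetric graph, the iterated resolvents of the delta function at the
root are radially decreasing and nonnegative. -/
theorem IsWeaklySphericallySymmetric.exists_antitone_euler_pow [Infinite V] {o : V}
    (h : G.IsWeaklySphericallySymmetric o) {ε : ℝ} (hε : 0 < ε) (k : ℕ) :
    ∃ c : ℕ → ℝ, Antitone c ∧ (∀ r, 0 ≤ c r) ∧
      (fun y => ((G.euler ε ^ k) (G.delta o) y).re) = fun y => c (G.dist y o) := by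
  induction k with
  | zero =>
    obtain ⟨h1, h2⟩ := antitone_dirac (G.m_pos o)
    refine ⟨_, h1, h2, funext fun y => ?_⟩
    exact G.re_delta_eq o y
  | succ k ih =>
    obtain ⟨g, hg, hg0, hgeq⟩ := ih
    have hsol := G.isResolventSolution_euler hε ((G.euler ε ^ k) (G.delta o))
    rw [hgeq] at hsol
    rw [pow_succ']
    exact h.exists_antitone hε hg hg0 hsol

variable {W : Type*} [MeasurableSpace W] [Countable W] [Infinite W] [DiscreteMeasurableSpace W]
  {Gsym : WeightedGraph W} {x₀ : V} {o : W}

/-- The equality of the root masses makes the initial delta functions agree. In each step the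
monotone profile `c` of the next model iterate is the supersolution, and the induction hypothesis
orders the right-hand sides. -/
theorem HasStrongerCurvatureGrowth.euler_pow_le (hG : G.HasStrongerCurvatureGrowth x₀ Gsym o)
    (hsym : Gsym.IsWeaklySphericallySymmetric o) {ε : ℝ} (hε : 0 < ε) (k : ℕ) {x : V} {y : W}
    (hxy : Gsym.dist y o = G.dist x x₀) :
    ((G.euler ε ^ k) (G.delta x₀) x).re ≤ ((Gsym.euler ε ^ k) (Gsym.delta o) y).re := by
  induction k generalizing x y with
  | zero =>
    change (G.delta x₀ x).re ≤ (Gsym.delta o y).re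
    rw [re_delta_eq, re_delta_eq, hxy, hG.1]
  | succ k ih =>
    obtain ⟨g, hg, hg0, hgeq⟩ := hsym.exists_antitone_euler_pow hε k
    obtain ⟨c, hc, hc0, hceq⟩ := hsym.exists_antitone_euler_pow hε (k + 1)
    have hu := G.isResolventSolution_euler hε ((G.euler ε ^ k) (G.delta x₀))
    have hv := Gsym.isResolventSolution_euler hε ((Gsym.euler ε ^ k) (Gsym.delta o))
    rw [congrFun hceq y, hxy]
    rw [pow_succ'] at hceq
    erw [hgeq, hceq] at hv
    rw [pow_succ']
    refine hG.resolvent_le hε hc hc0 (fun x => ?_) hu hv x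
    obtain ⟨z, hz⟩ := Gsym.sphere_nonempty o (G.dist x x₀)
    have hz' : Gsym.dist z o = G.dist x x₀ := hz
    refine (ih hz').trans_eq ?_
    rw [congrFun hgeq z, hz']

/-- Here it is the profile `g` of the current model iterate, the right-hand side, whose monotonicity
is used. -/
theorem HasWeakerCurvatureGrowth.euler_pow_le (hG : G.HasWeakerCurvatureGrowth x₀ Gsym o)
    (hsym : Gsym.IsWeaklySphericallySymmetric o) {ε : ℝ} (hε : 0 < ε) (k : ℕ) {x : V} {y : W}
    (hxy : Gsym.dist y o = G.dist x x₀) :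
    ((Gsym.euler ε ^ k) (Gsym.delta o) y).re ≤ ((G.euler ε ^ k) (G.delta x₀) x).re := by
  induction k generalizing x y with
  | zero =>
    change (Gsym.delta o y).re ≤ (G.delta x₀ x).re
    rw [re_delta_eq, re_delta_eq, hxy, hG.1]
  | succ k ih =>
    obtain ⟨g, hg, hg0, hgeq⟩ := hsym.exists_antitone_euler_pow hε k
    have hu := G.isResolventSolution_euler hε ((G.euler ε ^ k) (G.delta x₀))
    have hv := Gsym.isResolventSolution_euler hε ((Gsym.euler ε ^ k) (Gsym.delta o))
    rw [hgeq] at hv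
    rw [pow_succ', pow_succ']
    refine hG.resolvent_le hε hg hg0 (fun x => ?_) hu hv hxy.ge
    obtain ⟨z, hz⟩ := Gsym.sphere_nonempty o (G.dist x x₀)
    have hz' : Gsym.dist z o = G.dist x x₀ := hz
    rw [← hz', ← congrFun hgeq z]
    exact ih hz'

end WeightedGraph

theorem theoremt {V W : Type*}
    [Countable V] [Infinite V] [MeasurableSpace V] [DiscreteMeasurableSpace V]
    [Countable W] [Infinite W] [MeasurableSpace W] [DiscreteMeasurableSpace W]
    (G : WeightedGraph V) (x₀ : V) (Gsym : WeightedGraph W) (o : W)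
    (hsym : Gsym.IsWeaklySphericallySymmetric o) :
    (G.HasStrongerCurvatureGrowth x₀ Gsym o →
      ∀ r : ℕ, ∀ x ∈ G.sphere x₀ r, ∀ y ∈ Gsym.sphere o r, ∀ t : ℝ, 0 ≤ t →
        G.heatKernel t x₀ x ≤ Gsym.heatKernel t o y) ∧
    (G.HasWeakerCurvatureGrowth x₀ Gsym o →
      ∀ r : ℕ, ∀ x ∈ G.sphere x₀ r, ∀ y ∈ Gsym.sphere o r, ∀ t : ℝ, 0 ≤ t →
        Gsym.heatKernel t o y ≤ G.heatKernel t x₀ x) := by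
  refine ⟨fun hG r x hx y hy t ht => ?_, fun hG r x hx y hy t ht => ?_⟩
  all_goals
    have hxy : Gsym.dist y o = G.dist x x₀ := Eq.trans hy (Eq.symm hx)
    rw [G.heatKernel_symm, Gsym.heatKernel_symm]
    -- Time zero is separate because the Euler limit needs `t > 0`; there both kernels are delta
    -- functions with equal root masses.
    rcases ht.eq_or_lt with rfl | ht
    · rw [G.heatKernel_zero, Gsym.heatKernel_zero, hxy, hG.1]
  · exact le_of_tendsto_of_tendsto' (G.tendsto_euler_pow_delta ht x x₀)
      (Gsym.tendsto_euler_pow_delta ht y o)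
      fun n => hG.euler_pow_le hsym (by positivity) (n + 1) hxy
  · exact le_of_tendsto_of_tendsto' (Gsym.tendsto_euler_pow_delta ht y o)
      (G.tendsto_euler_pow_delta ht x x₀)
      fun n => hG.euler_pow_le hsym (by positivity) (n + 1) hxy
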